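/- All objects are finite. An implicational base $(X,\Sigma)$ is a set $\Sigma$ of implications $A\to B$ with $A,B\subseteq X$ disjoint. A set $C\subseteq X$ is closed if $A\subseteq C$ implies $B\subseteq C$ for every $A\to B\in\Sigma$. For $x\in X$, $\mathrm{irr}(x)$ is the family of inclusion-wise maximal closed sets not containing $x$ (the irreducible closed sets attached to $x$). The base is acyclic if the directed graph on $X$ with an arc $ab$ whenever $a\in A$, $b\in B$ for some $A\to B\in\Sigma$ has no directed cycle; its conclusion-degree is the maximum over $x\in X$ of the number of implications $A\to B\in\Sigma$ with $x\in B$. ACS-Enum is the problem of listing $\mathrm{irr}(x)$ given $(X,\Sigma)$ and $x\in X$. MIS-Enum is the problem of listing, given a hypergraph $H=(V,\mathcal E)$, the family $\mathrm{MIS}(H)$ of inclusion-wise maximal subsets of $V$ that contain no edge of $H$. Sets of edges and of implications are given by incidence vectors. **Theorem.** ACS-Enum is MIS-Enum-hard even for acyclic implicational bases of conclusion-degree at most $2$. That is, there is a map, computable by a Turing machine in polynomial time, that sends every hypergraph $H$ to an acyclic implicational base $(X,\Sigma)$ of conclusion-degree at most $2$ together with an element $z\in X$ such that $\mathrm{irr}(z)=\mathrm{MIS}(H)$.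 Moreover, on hypergraphs without an empty edge there is such a map for which, in addition, $\emptyset$ is always closed for $(X,\Sigma)$. -/

import Mathlib

/-! ### Hypergraphs and maximal independent sets -/

/-- `MIS(H)`: the inclusion-wise maximal sets of vertices that contain no edge of `H`. -/
def Hypergraph.maximalIndependentSets {α : Type*} (H : Hypergraph α) : Set (Set α) :=
  {I | Maximal (fun J : Set α => J ⊆ H.vertexSet ∧ ∀ E ∈ H.edgeSet, ¬ E ⊆ J) I}

/-! ### Implicational bases -/

/-- An implication `A → B` between two sets. -/
@[ext]
structure Implication (α : Type*) where
  premise : Set α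
  conclusion : Set α

/-- An implicational base `(X, Σ)`: a set of implications over the ground set `X`.  The premise and
the conclusion of an implication are disjoint. -/
structure ImplicationalBase (α : Type*) where
  ground : Set α
  implications : Set (Implication α)
  premise_subset : ∀ i ∈ implications, i.premise ⊆ ground
  conclusion_subset : ∀ i ∈ implications, i.conclusion ⊆ ground
  disjoint : ∀ i ∈ implications, Disjoint i.premise i.conclusion

namespace ImplicationalBase

variable {α : Type*}

/-- `C ⊆ X` is closed if it contains the conclusion of every implication whose premise it
contains. -/
def IsClosedSet (S : ImplicationalBase α) (C : Set α) : Prop :=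
  C ⊆ S.ground ∧ ∀ i ∈ S.implications, i.premise ⊆ C → i.conclusion ⊆ C

/-- `irr(x)`: the irreducible closed sets attached to `x`, that is, the inclusion-wise maximal
closed sets that do not contain `x`. -/
def irr (S : ImplicationalBase α) (x : α) : Set (Set α) :=
  {M | Maximal (fun C : Set α => S.IsClosedSet C ∧ x ∉ C) M}

/-- The arcs `ab` of the implication graph. -/
def Arc (S : ImplicationalBase α) (a b : α) : Prop :=
  ∃ i ∈ S.implications, a ∈ i.premise ∧ b ∈ i.conclusion

/-- The implication graph has no directed cycle. -/
def IsAcyclic (S : ImplicationalBase α) : Prop :=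
  ∀ a, ¬ Relation.TransGen S.Arc a a

/-- The conclusion-degree of an element: the number of implications that have it in their
conclusion. -/
noncomputable def conclusionDegreeAt (S : ImplicationalBase α) (x : α) : ℕ∞ :=
  {i ∈ S.implications | x ∈ i.conclusion}.encard

/-- The conclusion-degree of `(X, Σ)`: the maximum over the elements of `X`. -/
noncomputable def conclusionDegree (S : ImplicationalBase α) : ℕ∞ :=
  ⨆ x ∈ S.ground, S.conclusionDegreeAt x

end ImplicationalBase

/-! ### Enumeration problems and reductions -/

/-- An enumeration problem with solutions in `Sol`: each instance is written as a word over the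
alphabet `{0, 1, #}` (`some false`, `some true`, `none`), distinct instances as distinct words, and
the task is to list, without repetition, the solutions of a given instance. -/
structure EnumProblem (Sol : Type) where
  Inst : Type
  encode : Inst → List (Option Bool)
  encode_injective : Function.Injective encode
  solutions : Inst → Set Sol

namespace EnumProblem

variable {Sol : Type}

/-- The same problem on the instances that satisfy `p`. -/
def restrict (P : EnumProblem Sol) (p : P.Inst → Prop) : EnumProblem Sol where
  Inst := {I : P.Inst // p I}
  encode I := P.encode I.1
  encode_injective := P.encode_injective.comp Subtype.val_injective
  solutions I := P.solutions I.1

/-- `B` is `A`-hard: some map from the instances of `A` to the instances of `B` is computed by a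
Turing machine in polynomial time and preserves the set of solutions.  (This is a parsimonious
reduction whose map on solutions is the identity: running any algorithm for `B` on the image of an
instance of `A` lists the solutions of that instance of `A`.) -/
def IsHardFor (B A : EnumProblem Sol) : Prop :=
  ∃ f : A.Inst → B.Inst,
    Nonempty (Turing.TM2ComputableInPolyTime A.encode B.encode f) ∧
      ∀ I, B.solutions (f I) = A.solutions I

end EnumProblem

/-! ### Words for sets -/

/-- The incidence vector of `E ∩ {0, …, n - 1}`, followed by `#`. -/
def encodeRow (n : ℕ) (E : Finset ℕ) : List (Option Bool) :=
  (List.range n).map (fun i => some (decide (i ∈ E))) ++ [none]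

/-- The number `n` in unary, followed by `#`. -/
def encodeUnary (n : ℕ) : List (Option Bool) :=
  List.replicate n (some true) ++ [none]

theorem encodeUnary_append_inj {n m : ℕ} {u v : List (Option Bool)}
    (h : encodeUnary n ++ u = encodeUnary m ++ v) : n = m ∧ u = v := by
  induction n generalizing m with
  | zero =>
    cases m with
    | zero => simpa [encodeUnary] using h
    | succ m => simp [encodeUnary, List.replicate_succ] at h
  | succ n ih =>
    cases m with
    | zero => simp [encodeUnary, List.replicate_succ] at h
    | succ m =>
      have h' : encodeUnary n ++ u = encodeUnary m ++ v := by
        simpa [encodeUnary, List.replicate_succ] using h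
      exact ⟨by rw [(ih h').1], (ih h').2⟩

theorem encodeRow_append_inj {n : ℕ} {E F : Finset ℕ} (hE : E ⊆ Finset.range n)
    (hF : F ⊆ Finset.range n) {u v : List (Option Bool)}
    (h : encodeRow n E ++ u = encodeRow n F ++ v) : E = F ∧ u = v := by
  obtain ⟨h1, h2⟩ := List.append_inj h (by simp [encodeRow])
  refine ⟨?_, h2⟩
  simp only [encodeRow, List.append_cancel_right_eq, List.map_inj_left] at h1
  ext i
  by_cases hi : i < n
  · simpa using h1 i (by simpa using hi)
  · exact ⟨fun h => absurd (Finset.mem_range.1 (hE h)) hi,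
      fun h => absurd (Finset.mem_range.1 (hF h)) hi⟩

/-! ### The problem of listing the maximal independent sets of a hypergraph -/

/-- A hypergraph with vertex set `{0, …, n - 1}`, given by the list of its distinct edges. -/
@[ext]
structure HypergraphInstance where
  n : ℕ
  edges : List (Finset ℕ)
  nodup : edges.Nodup
  edges_subset : ∀ E ∈ edges, E ⊆ Finset.range n

namespace HypergraphInstance

/-- The hypergraph that is described by the instance. -/
def toHypergraph (I : HypergraphInstance) : Hypergraph ℕ where
  vertexSet := {v | v < I.n}
  edgeSet := {E | ∃ F ∈ I.edges, E = (F : Set ℕ)}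
  subset_vertexSet_of_mem_edgeSet' := by
    rintro _ ⟨F, hF, rfl⟩ v hv
    exact Finset.mem_range.1 (I.edges_subset F hF hv)

/-- The number of vertices in unary, then the incidence vectors of the edges. -/
def encode (I : HypergraphInstance) : List (Option Bool) :=
  encodeUnary I.n ++ I.edges.flatMap (encodeRow I.n)

theorem encode_injective : Function.Injective encode := by
  rintro ⟨n, l, hl, hs⟩ ⟨m, l', hl', hs'⟩ h
  obtain ⟨rfl, h⟩ := encodeUnary_append_inj h
  have key : ∀ l l' : List (Finset ℕ), (∀ E ∈ l, E ⊆ Finset.range n) →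
      (∀ E ∈ l', E ⊆ Finset.range n) →
      l.flatMap (encodeRow n) = l'.flatMap (encodeRow n) → l = l' := by
    intro l
    induction l with
    | nil =>
      intro l' _ _ h
      cases l' with
      | nil => rfl
      | cons F l' => exact absurd h.symm (by simp [encodeRow])
    | cons E l ih =>
      intro l' h1 h2 h
      cases l' with
      | nil => exact absurd h (by simp [encodeRow])
      | cons F l' =>
        simp only [List.flatMap_cons] at h
        obtain ⟨e, h'⟩ := encodeRow_append_inj (h1 E (by simp)) (h2 F (by simp)) h
        rw [ih l' (fun E hE => h1 E (by simp [hE])) (fun E hE => h2 E (by simp [hE])) h', e]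
  obtain rfl := key l l' hs hs' h
  rfl

end HypergraphInstance

/-- Given a hypergraph, list its maximal independent sets. -/
def MISEnum : EnumProblem (Set ℕ) where
  Inst := HypergraphInstance
  encode := HypergraphInstance.encode
  encode_injective := HypergraphInstance.encode_injective
  solutions I := I.toHypergraph.maximalIndependentSets

/-! ### The problem of listing the irreducible closed sets attached to an element -/

/-- An implicational base with ground set `{0, …, n - 1}`, given by the list of its distinct
implications `A → B` as pairs `(A, B)`, and an element of the ground set. -/
@[ext]
structure AttachedInstance where
  n : ℕ
  element : ℕ
  implications : List (Finset ℕ × Finset ℕ)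
  element_lt : element < n
  nodup : implications.Nodup
  premise_subset : ∀ i ∈ implications, i.1 ⊆ Finset.range n
  conclusion_subset : ∀ i ∈ implications, i.2 ⊆ Finset.range n
  disjoint : ∀ i ∈ implications, Disjoint i.1 i.2

namespace AttachedInstance

/-- The implicational base that is described by the instance. -/
def base (I : AttachedInstance) : ImplicationalBase ℕ where
  ground := {v | v < I.n}
  implications := {i | ∃ p ∈ I.implications, i = ⟨(p.1 : Set ℕ), (p.2 : Set ℕ)⟩}
  premise_subset := by
    rintro _ ⟨p, hp, rfl⟩ v hv
    exact Finset.mem_range.1 (I.premise_subset p hp hv)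
  conclusion_subset := by
    rintro _ ⟨p, hp, rfl⟩ v hv
    exact Finset.mem_range.1 (I.conclusion_subset p hp hv)
  disjoint := by
    rintro _ ⟨p, hp, rfl⟩
    exact Finset.disjoint_coe.2 (I.disjoint p hp)

/-- The size of the ground set in unary, then the element as the incidence vector of a singleton,
then, for each implication, the incidence vectors of the premise and of the conclusion. -/
def encode (I : AttachedInstance) : List (Option Bool) :=
  encodeUnary I.n ++ (encodeRow I.n {I.element} ++
    I.implications.flatMap (fun i => encodeRow I.n i.1 ++ encodeRow I.n i.2))

theorem encode_injective : Function.Injective encode := by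
  rintro ⟨n, x, l, hx, hl, hs, hc, hd⟩ ⟨m, y, l', hy, hl', hs', hc', hd'⟩ h
  obtain ⟨rfl, h⟩ := encodeUnary_append_inj h
  obtain ⟨hxy, h⟩ := encodeRow_append_inj (by simpa using hx) (by simpa using hy) h
  obtain rfl : x = y := by simpa using hxy
  have key : ∀ l l' : List (Finset ℕ × Finset ℕ),
      (∀ i ∈ l, i.1 ⊆ Finset.range n ∧ i.2 ⊆ Finset.range n) →
      (∀ i ∈ l', i.1 ⊆ Finset.range n ∧ i.2 ⊆ Finset.range n) →
      l.flatMap (fun i => encodeRow n i.1 ++ encodeRow n i.2) =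
        l'.flatMap (fun i => encodeRow n i.1 ++ encodeRow n i.2) → l = l' := by
    intro l
    induction l with
    | nil =>
      intro l' _ _ h
      cases l' with
      | nil => rfl
      | cons F l' => exact absurd h.symm (by simp [encodeRow])
    | cons E l ih =>
      intro l' h1 h2 h
      cases l' with
      | nil => exact absurd h (by simp [encodeRow])
      | cons F l' =>
        simp only [List.flatMap_cons, List.append_assoc] at h
        obtain ⟨e1, h⟩ := encodeRow_append_inj (h1 E (by simp)).1 (h2 F (by simp)).1 h
        obtain ⟨e2, h'⟩ := encodeRow_append_inj (h1 E (by simp)).2 (h2 F (by simp)).2 h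
        rw [ih l' (fun E hE => h1 E (by simp [hE])) (fun E hE => h2 E (by simp [hE])) h',
          Prod.ext e1 e2]
  obtain rfl := key l l' (fun i hi => ⟨hs i hi, hc i hi⟩) (fun i hi => ⟨hs' i hi, hc' i hi⟩) h
  rfl

end AttachedInstance

/-- Given an implicational base `(X, Σ)` and `x ∈ X`, list the irreducible closed sets attached
to `x`. -/
def ACSEnum : EnumProblem (Set ℕ) where
  Inst := AttachedInstance
  encode := AttachedInstance.encode
  encode_injective := AttachedInstance.encode_injective
  solutions I := I.base.irr I.element

/-! ### The reduction -/

/-! Give every edge `E_j` a new element `n + j` and link the new elements in a chain `n → n + 1 → ⋯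
→ n + m = z`, where `m` is the number of edges. A set containing an edge, or any new element, is
forced along the chain to contain `z`. Conversely, a set of vertices containing no edge satisfies
every premise vacuously. So the closed sets avoiding `z` are exactly the independent sets
(`isClosedSet_toAttached_iff`), and the maximal ones agree. The chain replaces the `m` implications
`E_j → z`: each new element is reached only from its own edge and from its predecessor, hence the
degree bound 2, and all arcs increase, hence acyclicity.

Polynomial time is shown by an explicit stack machine. Every row to be written is `n` letters, then
a block of zeros with at most one 1. The position of that 1 is held by two unary counters: `j`, the
edges still to be treated, and `b`, those already treated. A pushed letter lands in front of the
word, so the edges are treated from last to first. `run_machine` describes the whole run,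
`encode_toAttached` identifies its output with the required word, and the number of steps is
quadratic in the input length. -/

/-- The implications `E_j → {n + j}` and `{n + j} → {n + j + 1}` for the `j`-th set `E_j` of a
list. -/
def chainImplications (n : ℕ) (es : List (Finset ℕ)) : List (Finset ℕ × Finset ℕ) :=
  es.zipIdx.flatMap fun p => [(p.1, {n + p.2}), ({n + p.2}, {n + p.2 + 1})]

theorem chainImplications_concat (n : ℕ) (es : List (Finset ℕ)) (E : Finset ℕ) :
    chainImplications n (es ++ [E]) = chainImplications n es ++
      [(E, {n + es.length}), ({n + es.length}, {n + es.length + 1})] := by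
  simp [chainImplications, List.zipIdx_append]

theorem mem_chainImplications {n : ℕ} {es : List (Finset ℕ)} {p : Finset ℕ × Finset ℕ} :
    p ∈ chainImplications n es ↔ ∃ j E, es[j]? = some E ∧
      (p = (E, {n + j}) ∨ p = ({n + j}, {n + j + 1})) := by
  simp only [chainImplications, List.mem_flatMap, Prod.exists, List.mem_zipIdx_iff_getElem?,
    List.mem_cons, List.not_mem_nil, or_false]
  exact exists_comm

theorem lt_length_of_getElem?_eq_some {β : Type*} {l : List β} {j : ℕ} {a : β}
    (h : l[j]? = some a) : j < l.length :=
  (List.getElem?_eq_some_iff.1 h).1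

/-- An earlier pair can share a conclusion with a new one only as `({n + j}, {n + j + 1})` against
`(E, {n + j + 1})`, and then the premises differ because `E` lies below `n`. -/
theorem nodup_chainImplications {n : ℕ} {es : List (Finset ℕ)}
    (h : ∀ E ∈ es, E ⊆ Finset.range n) : (chainImplications n es).Nodup := by
  induction es using List.reverseRecOn with
  | nil => simp [chainImplications]
  | append_singleton es E ih =>
    have hE : E ⊆ Finset.range n := h E (by simp)
    have hne : ∀ j, E ≠ {n + j} := by
      rintro j rfl
      simp at hE
    rw [chainImplications_concat, List.nodup_append]
    refine ⟨ih fun F hF => h F (by simp [hF]), by simp [hne], ?_⟩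
    rintro p hp q hq rfl
    obtain ⟨j, F, hj, hp⟩ := mem_chainImplications.1 hp
    have hlt := lt_length_of_getElem?_eq_some hj
    simp only [List.mem_cons, List.not_mem_nil, or_false] at hq
    rcases hp with rfl | rfl <;> rcases hq with hq | hq <;>
      simp only [Prod.mk.injEq, Finset.singleton_inj] at hq
    · omega
    · omega
    · exact hne j hq.1.symm
    · omega

namespace HypergraphInstance

variable (I : HypergraphInstance)

theorem subset_range_of_getElem? {j : ℕ} {E : Finset ℕ} (h : I.edges[j]? = some E) :
    E ⊆ Finset.range I.n :=
  I.edges_subset E (List.mem_of_getElem? h)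

/-- The vertices of a hypergraph, one further element `n + j` for the `j`-th edge, and an element
`z = n + m`, where `m` is the number of edges; the `j`-th edge implies `n + j`, which implies
`n + j + 1`. -/
def toAttached : AttachedInstance where
  n := I.n + I.edges.length + 1
  element := I.n + I.edges.length
  implications := chainImplications I.n I.edges
  element_lt := Nat.lt_succ_self _
  nodup := nodup_chainImplications I.edges_subset
  premise_subset p hp := by
    obtain ⟨j, E, hj, rfl | rfl⟩ := mem_chainImplications.1 hp
    · exact (I.subset_range_of_getElem? hj).trans (Finset.range_mono (by omega))
    · have := lt_length_of_getElem?_eq_some hj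
      simp only [Finset.singleton_subset_iff, Finset.mem_range]
      omega
  conclusion_subset p hp := by
    obtain ⟨j, E, hj, rfl | rfl⟩ := mem_chainImplications.1 hp <;>
    · have := lt_length_of_getElem?_eq_some hj
      simp only [Finset.singleton_subset_iff, Finset.mem_range]
      omega
  disjoint p hp := by
    obtain ⟨j, E, hj, rfl | rfl⟩ := mem_chainImplications.1 hp
    · rw [Finset.disjoint_singleton_right]
      intro h
      have := I.subset_range_of_getElem? hj h
      simp at this
    · simp

theorem exists_of_mem_implications {i : Implication ℕ}
    (hi : i ∈ I.toAttached.base.implications) :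
    ∃ (j : ℕ) (E : Finset ℕ), I.edges[j]? = some E ∧
      (i = ⟨(E : Set ℕ), {I.n + j}⟩ ∨ i = ⟨{I.n + j}, {I.n + j + 1}⟩) := by
  obtain ⟨p, hp, rfl⟩ := hi
  obtain ⟨j, E, hj, rfl | rfl⟩ := mem_chainImplications.1 hp
  · exact ⟨j, E, hj, Or.inl (by simp)⟩
  · exact ⟨j, E, hj, Or.inr (by simp)⟩

theorem edge_mem_implications {j : ℕ} {E : Finset ℕ} (hj : I.edges[j]? = some E) :
    ⟨(E : Set ℕ), {I.n + j}⟩ ∈ I.toAttached.base.implications :=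
  ⟨(E, {I.n + j}), mem_chainImplications.2 ⟨j, E, hj, Or.inl rfl⟩, by simp⟩

theorem succ_mem_implications {j : ℕ} (hj : j < I.edges.length) :
    ⟨{I.n + j}, {I.n + j + 1}⟩ ∈ I.toAttached.base.implications :=
  ⟨({I.n + j}, {I.n + j + 1}),
    mem_chainImplications.2 ⟨j, _, List.getElem?_eq_getElem hj, Or.inr rfl⟩, by simp⟩

/-- The usual order on `ℕ` is a topological order of the implication graph. -/
theorem isAcyclic_toAttached : I.toAttached.base.IsAcyclic := by
  have harc : ∀ a b, I.toAttached.base.Arc a b → a < b := by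
    rintro a b ⟨i, hi, ha, hb⟩
    obtain ⟨j, E, hj, rfl | rfl⟩ := I.exists_of_mem_implications hi
    · have h1 := Finset.mem_range.1 (I.subset_range_of_getElem? hj ha)
      have h2 : b = I.n + j := hb
      omega
    · have h1 : a = I.n + j := ha
      have h2 : b = I.n + j + 1 := hb
      omega
  intro a h
  have hlt : ∀ b, Relation.TransGen I.toAttached.base.Arc a b → a < b := by
    intro b hb
    induction hb with
    | single hb => exact harc _ _ hb
    | tail _ hb ih => exact ih.trans (harc _ _ hb)
  exact lt_irrefl a (hlt a h)

theorem conclusionDegree_toAttached_le : I.toAttached.base.conclusionDegree ≤ 2 := by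
  refine iSup₂_le fun x _ => ?_
  -- The only candidates concluding `x` come from edge `x - n` and from the predecessor `x - 1`.
  -- Only an inclusion is needed, so the default `∅` and truncated subtraction do no harm.
  refine (Set.encard_le_encard (t := {⟨((I.edges.getD (x - I.n) ∅ : Finset ℕ) : Set ℕ), {x}⟩,
    ⟨{x - 1}, {x}⟩}) ?_).trans ((Set.encard_insert_le _ _).trans
    (by rw [Set.encard_singleton]; exact one_add_one_eq_two.le))
  rintro i ⟨hi, hx⟩
  obtain ⟨j, E, hj, rfl | rfl⟩ := I.exists_of_mem_implications hi
  · obtain rfl : x = I.n + j := hx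
    left
    simp [List.getD_eq_getElem?_getD, hj]
  · obtain rfl : x = I.n + j + 1 := hx
    right
    simp

theorem isClosedSet_toAttached_iff (C : Set ℕ) :
    I.toAttached.base.IsClosedSet C ∧ I.toAttached.element ∉ C ↔
      C ⊆ I.toHypergraph.vertexSet ∧ ∀ E ∈ I.toHypergraph.edgeSet, ¬ E ⊆ C := by
  constructor
  · rintro ⟨⟨hC, himp⟩, hz⟩
    -- The absence of `z` travels backwards along the chain.
    have hchain : ∀ j ≤ I.edges.length, I.n + j ∉ C := by
      intro j hj
      induction hj using Nat.decreasingInduction with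
      | self => exact hz
      | of_succ j hj ih =>
        intro h
        have := himp _ (I.succ_mem_implications hj) (Set.singleton_subset_iff.2 h)
        exact ih (Set.singleton_subset_iff.1 this)
    refine ⟨fun v hv => ?_, ?_⟩
    · by_contra hn
      have h1 : ¬ v < I.n := hn
      have h2 : v < I.n + I.edges.length + 1 := hC hv
      refine hchain (v - I.n) (by omega) ?_
      rwa [Nat.add_sub_cancel' (by omega)]
    · rintro _ ⟨E, hE, rfl⟩ hEC
      obtain ⟨j, hj⟩ := List.mem_iff_getElem?.1 hE
      exact hchain j (lt_length_of_getElem?_eq_some hj).le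
        (Set.singleton_subset_iff.1 (himp _ (I.edge_mem_implications hj) hEC))
  · rintro ⟨hC, hE⟩
    have hlt : ∀ v ∈ C, v < I.n := hC
    have hge : ∀ j, I.n + j ∉ C := fun j h => by have := hlt _ h; omega
    refine ⟨⟨fun v hv => ?_, fun i hi hprem => ?_⟩, hge _⟩
    · have := hlt v hv
      change v < I.n + I.edges.length + 1
      omega
    · obtain ⟨j, E, hj, rfl | rfl⟩ := I.exists_of_mem_implications hi
      · exact absurd hprem (hE _ ⟨E, List.mem_of_getElem? hj, rfl⟩)
      · exact absurd (Set.singleton_subset_iff.1 hprem) (hge j)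

theorem irr_toAttached :
    I.toAttached.base.irr I.toAttached.element = I.toHypergraph.maximalIndependentSets := by
  simp only [ImplicationalBase.irr, Hypergraph.maximalIndependentSets,
    I.isClosedSet_toAttached_iff]

theorem isClosedSet_empty_toAttached (h : ∅ ∉ I.toHypergraph.edgeSet) :
    I.toAttached.base.IsClosedSet ∅ := by
  refine ((I.isClosedSet_toAttached_iff ∅).2 ⟨Set.empty_subset _, fun E hE hE' => h ?_⟩).1
  rwa [← Set.subset_empty_iff.1 hE']

end HypergraphInstance

/-! ### Iterated steps with a bound on their number -/

/-- Iterating `f` leads from `a` to `b` in at most `t` steps. -/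
def ReachesWithin {σ : Type*} (f : σ → Option σ) (t : ℕ) (a b : σ) : Prop :=
  ∃ s ≤ t, (flip bind f)^[s] (some a) = some b

namespace ReachesWithin

variable {σ : Type*} {f : σ → Option σ} {s t : ℕ} {a b c : σ}

theorem refl (a : σ) : ReachesWithin f 0 a a := ⟨0, le_rfl, rfl⟩

theorem trans (h₁ : ReachesWithin f s a b) (h₂ : ReachesWithin f t b c) :
    ReachesWithin f (s + t) a c := by
  obtain ⟨m, hm, h₁⟩ := h₁
  obtain ⟨n, hn, h₂⟩ := h₂
  exact ⟨n + m, by omega, by rw [Function.iterate_add_apply, h₁, h₂]⟩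

theorem single (h : f a = some b) : ReachesWithin f 1 a b := ⟨1, le_rfl, h⟩

theorem head (h₁ : f a = some b) (h₂ : ReachesWithin f t b c) : ReachesWithin f (t + 1) a c :=
  add_comm 1 t ▸ (single h₁).trans h₂

theorem mono (h : ReachesWithin f s a b) (hst : s ≤ t) : ReachesWithin f t a b := by
  obtain ⟨m, hm, h⟩ := h
  exact ⟨m, hm.trans hst, h⟩

theorem nonempty_evalsToInTime (h : ReachesWithin f t a b) :
    Nonempty (StateTransition.EvalsToInTime f a (some b) t) := by
  obtain ⟨m, hm, h⟩ := h
  exact ⟨⟨⟨m, h⟩, hm⟩⟩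

end ReachesWithin

/-! ### A machine that computes the reduction -/

namespace ReductionMachine

open Turing

/-- The stacks: the input, the incidence vectors of the edges in reverse, the output, and two copies
of each of three unary counters. -/
inductive Stack
  | inp | rows | out
  | v (d : Bool) | j (d : Bool) | b (d : Bool)
  deriving DecidableEq, Fintype

/-- The labels of the program.  For each edge, four rows are written, one for each pair `(h, d)`;
the counters are moved from their copies `d` to their copies `!d` while a row is written. -/
inductive Label
  | readVertices | readEdges | loop
  | start (h d : Bool) | rowB (h d : Bool) | rowJ (h d : Bool) | rowV (h d : Bool)
  | shift | zeroV | zeroB | oneV | oneB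
  deriving Fintype

/-- The letters of the words. -/
abbrev Letter := Option Bool

/-- What follows a row. -/
def next : Bool → Bool → Label
  | false, false => .shift
  | false, true => .start true false
  | true, false => .start true true
  | true, true => .loop

/-- The statements of the program. -/
abbrev Stmt := TM2.Stmt (fun _ : Stack => Letter) Label (Option Letter)

/-- Pop a letter from `k` into the register; then do `q₁` if there was one, and `q₂` if not. -/
abbrev popThen (k : Stack) (q₁ q₂ : Stmt) : Stmt :=
  .pop k (fun _ x => x) (.branch Option.isSome q₁ q₂)

/-- Push the letter `a`. -/
abbrev write (k : Stack) (a : Letter) (q : Stmt) : Stmt := .push k (fun _ => a) q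

/-- Go to a label. -/
abbrev jump (l : Label) : Stmt := .goto fun _ => l

/-- The program.  The words are written from right to left. -/
def program : Label → Stmt
  | .readVertices =>
    .pop .inp (fun _ x => x) <| .branch (fun x => x == some (some true))
      (write (.v false) (some false) <| jump .readVertices) (jump .readEdges)
  | .readEdges =>
    popThen .inp
      (.branch (fun x => x == some none)
        (write (.j false) (some false) <| jump .readEdges)
        (.push .rows (fun x => x.getD none) <| jump .readEdges))
      (jump .loop)
  | .loop =>
    .peek (.j false) (fun _ x => x) <| .branch Option.isSome
      (jump (.start false false)) (write .out none <| write .out (some true) <| jump .zeroV)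
  | .start h d => write .out none <| jump (.rowB h d)
  | .rowB h d =>
    popThen (.b d)
      (write (.b !d) (some false) <| write .out (some false) <| jump (.rowB h d))
      (write .out (some !(h && d)) <| jump (.rowJ h d))
  | .rowJ h d =>
    popThen (.j d)
      (write (.j !d) (some false) <| write .out (some false) <| jump (.rowJ h d))
      (jump (.rowV h d))
  | .rowV h d =>
    popThen (.v d)
      (write (.v !d) (some false) <| .branch (fun _ => h && d)
        (.pop .rows (fun _ x => x) <| .push .out (fun x => x.getD none) <| jump (.rowV h d))
        (write .out (some false) <| jump (.rowV h d)))
      (jump (next h d))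
  | .shift =>
    .pop (.j true) (fun x _ => x) <| write (.b true) (some false) <| jump (.start false true)
  | .zeroV =>
    popThen (.v false)
      (write (.v true) (some false) <| write .out (some false) <| jump .zeroV) (jump .zeroB)
  | .zeroB =>
    popThen (.b false)
      (write (.b true) (some false) <| write .out (some false) <| jump .zeroB)
      (write .out none <| write .out (some true) <| jump .oneV)
  | .oneV => popThen (.v true) (write .out (some true) <| jump .oneV) (jump .oneB)
  | .oneB => popThen (.b true) (write .out (some true) <| jump .oneB) .halt

/-- The machine. -/
def machine : FinTM2 where
  K := Stack
  k₀ := .inp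
  k₁ := .out
  Γ _ := Letter
  Λ := Label
  main := .readVertices
  σ := Option Letter
  initialState := none
  Γk₀Fin := inferInstanceAs (Fintype (Option Bool))
  m := program

/-- The configurations of the machine. -/
abbrev Cfg := TM2.Cfg (fun _ : Stack => Letter) Label (Option Letter)

/-- A unary counter. -/
def counter (n : ℕ) : List Letter := List.replicate n (some false)

@[simp] theorem counter_zero : counter 0 = [] := rfl

@[simp] theorem counter_succ (n : ℕ) : counter (n + 1) = some false :: counter n := rfl

/-- The contents of the stacks; `v`, `j`, `b` are the values of the copies `d` of the counters, and
`v'`, `j'`, `b'` those of the copies `!d`. -/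
def contents (d : Bool) (inp rows out : List Letter) (v v' j j' b b' : ℕ) : Stack → List Letter
  | .inp => inp
  | .rows => rows
  | .out => out
  | .v e => counter (if e = d then v else v')
  | .j e => counter (if e = d then j else j')
  | .b e => counter (if e = d then b else b')

/-- After a row the counters sit in the copies `!d`; this restores the normal form for the next row
without moving them back. -/
theorem contents_not (d : Bool) (inp rows out : List Letter) (v v' j j' b b' : ℕ) :
    contents (!d) inp rows out v v' j j' b b' = contents d inp rows out v' v j' j b' b := by
  funext k
  cases d <;> rcases k with _ | _ | _ | (_ | _) | (_ | _) | (_ | _) <;> rfl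

/-- The machine goes from one configuration to another in at most `t` steps. -/
abbrev Runs (t : ℕ) (c c' : Cfg) : Prop := ReachesWithin (TM2.step program) t c c'

variable {i r o : List Letter} {x : Option Letter} {v v' j j' b b' : ℕ} {h d : Bool}

theorem step_eq {l : Label} {S : Stack → List Letter} {c : Cfg}
    (hc : TM2.stepAux (program l) x S = c) : TM2.step program ⟨some l, x, S⟩ = some c :=
  congrArg some hc

theorem cfg_eq {l l' : Option Label} {x x' : Option Letter} {S S' : Stack → List Letter}
    (hl : l = l') (hx : x = x') (hS : ∀ k, S k = S' k) : (⟨l, x, S⟩ : Cfg) = ⟨l', x', S'⟩ := by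
  rw [hl, hx, funext hS]

/-! ### Writing the rows of the implications -/

theorem run_rowB : Runs (b + 1)
    ⟨some (.rowB h d), x, contents d i r o v v' j j' b b'⟩
    ⟨some (.rowJ h d), none,
      contents d i r (some (!(h && d)) :: (counter b ++ o)) v v' j j' 0 (b + b')⟩ := by
  induction b generalizing x o b' with
  | zero =>
    refine .single (step_eq ?_)
    cases d <;> refine cfg_eq rfl (by simp [contents]) fun k => ?_ <;>
      rcases k with _ | _ | _ | (_ | _) | (_ | _) | (_ | _) <;> simp [contents]
  | succ b ih =>
    have := ih (x := some (some false)) (o := some false :: o) (b' := b' + 1)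
    rw [show b + (b' + 1) = b + 1 + b' by omega] at this
    refine .head (step_eq ?_) (by simpa [counter, List.replicate_succ'] using this)
    cases d <;> refine cfg_eq rfl (by simp [contents]) fun k => ?_ <;>
      rcases k with _ | _ | _ | (_ | _) | (_ | _) | (_ | _) <;> simp [contents]

theorem counter_append_cons (n : ℕ) (o : List Letter) :
    counter n ++ some false :: o = some false :: (counter n ++ o) := by
  induction n with
  | zero => rfl
  | succ n ih => simp [ih]

theorem run_rowJ : Runs (j + 1)
    ⟨some (.rowJ h d), x, contents d i r o v v' j j' b b'⟩
    ⟨some (.rowV h d), none, contents d i r (counter j ++ o) v v' 0 (j + j') b b'⟩ := by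
  induction j generalizing x o j' with
  | zero =>
    refine .single (step_eq ?_)
    cases d <;> refine cfg_eq rfl (by simp [contents]) fun k => ?_ <;>
      rcases k with _ | _ | _ | (_ | _) | (_ | _) | (_ | _) <;> simp [contents]
  | succ j ih =>
    have := ih (x := some (some false)) (o := some false :: o) (j' := j' + 1)
    rw [show j + (j' + 1) = j + 1 + j' by omega] at this
    refine .head (step_eq ?_) (by simpa [counter_append_cons] using this)
    cases d <;> refine cfg_eq rfl (by simp [contents]) fun k => ?_ <;>
      rcases k with _ | _ | _ | (_ | _) | (_ | _) | (_ | _) <;> simp [contents]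

theorem run_rowV (hd : (h && d) = false) : Runs (v + 1)
    ⟨some (.rowV h d), x, contents d i r o v v' j j' b b'⟩
    ⟨some (next h d), none, contents d i r (counter v ++ o) 0 (v + v') j j' b b'⟩ := by
  induction v generalizing x o v' with
  | zero =>
    refine .single (step_eq ?_)
    cases d <;> refine cfg_eq (by simp) (by simp [contents]) fun k => ?_ <;>
      rcases k with _ | _ | _ | (_ | _) | (_ | _) | (_ | _) <;> simp [contents]
  | succ v ih =>
    have := ih (x := some (some false)) (o := some false :: o) (v' := v' + 1)
    rw [show v + (v' + 1) = v + 1 + v' by omega] at this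
    refine .head (step_eq ?_) (by simpa [counter_append_cons] using this)
    cases d <;> refine cfg_eq (by simp [contents, hd]) (by simp [contents, hd]) fun k => ?_ <;>
      rcases k with _ | _ | _ | (_ | _) | (_ | _) | (_ | _) <;> simp [contents, hd]

/-- The vector was reversed on `rows`, and moving it to `out` reverses it back. The counter `v`
marks where it ends, so no separators are stored. -/
theorem run_rowV_edge (l : List Letter) : Runs (l.length + 1)
    ⟨some (.rowV true true), x, contents true i (l ++ r) o l.length v' j j' b b'⟩
    ⟨some .loop, none, contents true i r (l.reverse ++ o) 0 (l.length + v') j j' b b'⟩ := by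
  induction l generalizing x o v' with
  | nil =>
    refine .single (step_eq ?_)
    refine cfg_eq (by simp [next]) (by simp [contents]) fun k => ?_
    rcases k with _ | _ | _ | (_ | _) | (_ | _) | (_ | _) <;> simp [contents]
  | cons a l ih =>
    have := ih (x := some a) (o := a :: o) (v' := v' + 1)
    rw [show l.length + (v' + 1) = l.length + 1 + v' by omega] at this
    refine .head (step_eq ?_) (by simpa using this)
    refine cfg_eq (by simp) (by simp [contents]) fun k => ?_
    rcases k with _ | _ | _ | (_ | _) | (_ | _) | (_ | _) <;> simp [contents]

/-- A row without its first `n` letters: `j` zeros, the letter `a`, `b` zeros and `#`. -/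
def rowEnd (j b : ℕ) (a : Bool) : List Letter :=
  counter j ++ some a :: (counter b ++ [none])

theorem run_start : Runs (j + b + 3)
    ⟨some (.start h d), x, contents d i r o v 0 j 0 b 0⟩
    ⟨some (.rowV h d), none,
      contents d i r (rowEnd j b (!(h && d)) ++ o) v 0 0 j 0 b⟩ := by
  have h₁ : TM2.step program ⟨some (.start h d), x, contents d i r o v 0 j 0 b 0⟩ =
      some ⟨some (.rowB h d), x, contents d i r (none :: o) v 0 j 0 b 0⟩ := by
    refine step_eq (cfg_eq rfl rfl fun k => ?_)
    rcases k with _ | _ | _ | (_ | _) | (_ | _) | (_ | _) <;> simp [contents]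
  have := (run_rowB.trans run_rowJ).head h₁
  simpa [rowEnd] using this.mono (t := j + b + 3) (by omega)

theorem run_row (hd : (h && d) = false) : Runs (v + j + b + 4)
    ⟨some (.start h d), x, contents d i r o v 0 j 0 b 0⟩
    ⟨some (next h d), none,
      contents (!d) i r (counter v ++ rowEnd j b true ++ o) v 0 j 0 b 0⟩ := by
  have := (run_start (h := h) (d := d) (x := x) (i := i) (r := r) (o := o) (v := v) (j := j)
    (b := b)).trans (run_rowV hd)
  rw [hd] at this
  rw [contents_not]
  simpa using this.mono (t := v + j + b + 4) (by omega)

theorem run_row_edge (l : List Letter) : Runs (l.length + j + b + 4)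
    ⟨some (.start true true), x, contents true i (l ++ r) o l.length 0 j 0 b 0⟩
    ⟨some .loop, none,
      contents false i r (l.reverse ++ rowEnd j b false ++ o) l.length 0 j 0 b 0⟩ := by
  have := (run_start (h := true) (d := true) (x := x) (i := i) (r := l ++ r) (o := o)
    (v := l.length) (j := j) (b := b)).trans (run_rowV_edge l)
  rw [← Bool.not_true, contents_not]
  simpa using this.mono (t := l.length + j + b + 4) (by omega)

/-- Moving one unit from `j` to `b` moves the 1 from column `n + j + 1` to column `n + j` and keeps
the row length. -/
theorem run_shift : Runs 1
    ⟨some .shift, x, contents true i r o v 0 (j + 1) 0 b 0⟩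
    ⟨some (.start false true), x, contents true i r o v 0 j 0 (b + 1) 0⟩ := by
  refine .single (step_eq (cfg_eq rfl rfl fun k => ?_))
  rcases k with _ | _ | _ | (_ | _) | (_ | _) | (_ | _) <;> simp [contents]

/-- One round of the loop: the rows that belong to one edge. -/
theorem run_round (l : List Letter) : Runs (4 * (l.length + j + b + 5) + 2)
    ⟨some .loop, x, contents false i (l ++ r) o l.length 0 (j + 1) 0 b 0⟩
    ⟨some .loop, none, contents false i r
      (l.reverse ++ rowEnd j (b + 1) false ++
        (counter l.length ++ rowEnd j (b + 1) true ++
        (counter l.length ++ rowEnd j (b + 1) true ++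
        (counter l.length ++ rowEnd (j + 1) b true ++ o))))
      l.length 0 j 0 (b + 1) 0⟩ := by
  have h₁ : TM2.step program
        ⟨some .loop, x, contents false i (l ++ r) o l.length 0 (j + 1) 0 b 0⟩ =
      some ⟨some (.start false false), some (some false),
        contents false i (l ++ r) o l.length 0 (j + 1) 0 b 0⟩ :=
    step_eq (cfg_eq (by simp) (by simp [contents]) fun k => by simp [contents])
  -- From right to left: the conclusion `{n + j + 1}`, the shift, then `{n + j}` twice (as a premise
  -- and as a conclusion), and finally the edge.
  have h₂ := ((((run_row (h := false) (d := false) (x := some (some false)) (i := i) (r := l ++ r) (o := o)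
    (v := l.length) (j := j + 1) (b := b) rfl).trans run_shift).trans
    (run_row (h := false) (d := true) rfl)).trans (run_row (h := true) (d := false) rfl)).trans
    (run_row_edge l)
  -- Four rows of equal cost, plus one step for the test and one for the shift.
  exact (h₂.head h₁).mono (by omega)

/-- The rows for a list of edges with incidence vectors `ls`, when `b` edges follow. -/
def rowsOf (n : ℕ) : List (List Letter) → ℕ → ℕ → List Letter
  | [], _, _ => []
  | l :: ls, j, b =>
    l ++ rowEnd j (b + ls.length + 1) false ++
      (counter n ++ rowEnd j (b + ls.length + 1) true ++
      (counter n ++ rowEnd j (b + ls.length + 1) true ++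
      (counter n ++ rowEnd (j + 1) (b + ls.length) true))) ++ rowsOf n ls (j + 1) b

/-- The machine treats the last edge first, so its loop is matched by splitting off the end of the
list. -/
theorem rowsOf_concat (n : ℕ) (ls : List (List Letter)) (l : List Letter) (j b : ℕ) :
    rowsOf n (ls ++ [l]) j b = rowsOf n ls j (b + 1) ++
      (l ++ rowEnd (j + ls.length) (b + 1) false ++
      (counter n ++ rowEnd (j + ls.length) (b + 1) true ++
      (counter n ++ rowEnd (j + ls.length) (b + 1) true ++
      (counter n ++ rowEnd (j + ls.length + 1) b true)))) := by
  induction ls generalizing j with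
  | nil => simp [rowsOf]
  | cons l' ls ih =>
    simp only [List.cons_append, rowsOf, ih, List.length_append, List.length_cons,
      List.length_nil]
    simp only [List.append_assoc, show b + 1 + ls.length = b + (ls.length + 1) by omega,
      show j + 1 + ls.length = j + (ls.length + 1) by omega, zero_add]

theorem run_loop {n : ℕ} (ls : List (List Letter)) (hls : ∀ l ∈ ls, l.length = n) :
    Runs (ls.length * (4 * (n + ls.length + b + 5) + 2))
      ⟨some .loop, none, contents false i ls.flatten.reverse o n 0 ls.length 0 b 0⟩
      ⟨some .loop, none,
        contents false i [] (rowsOf n ls 0 b ++ o) n 0 0 0 (b + ls.length) 0⟩ := by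
  induction ls using List.reverseRecOn generalizing o b with
  | nil => simpa [rowsOf] using ReachesWithin.refl _
  | append_singleton ls l ih =>
    have hl : l.reverse.length = n := by simpa using hls l (by simp)
    have h₁ := run_round (i := i) (r := ls.flatten.reverse) (o := o) (x := none) (j := ls.length)
      (b := b) l.reverse
    have h₂ := h₁.trans (by
      rw [hl]; exact ih (fun m hm => hls m (by simp [hm])))
    rw [hl] at h₂
    have h₃ := h₂.mono (t := (ls ++ [l]).length * (4 * (n + (ls ++ [l]).length + b + 5) + 2)) (by
      simp only [List.length_append, List.length_cons, List.length_nil]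
      -- A round leaves the sum of `j` and `b` unchanged, so one bound serves all rounds.
      rw [show n + ls.length + (b + 1) + 5 = n + (ls.length + (0 + 1)) + b + 5 by omega]
      nlinarith)
    have e : b + 1 + ls.length = b + (ls.length + 1) := by omega
    simpa [rowsOf_concat, e] using h₃

/-! ### Writing the ground set and the element -/

theorem run_zeroV : Runs (v + 1)
    ⟨some .zeroV, x, contents false i r o v v' j j' b b'⟩
    ⟨some .zeroB, none, contents false i r (counter v ++ o) 0 (v + v') j j' b b'⟩ := by
  induction v generalizing x o v' with
  | zero =>
    refine .single (step_eq (cfg_eq rfl (by simp [contents]) fun k => ?_))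
    rcases k with _ | _ | _ | (_ | _) | (_ | _) | (_ | _) <;> simp [contents]
  | succ v ih =>
    have := ih (x := some (some false)) (o := some false :: o) (v' := v' + 1)
    rw [show v + (v' + 1) = v + 1 + v' by omega] at this
    refine .head (step_eq ?_) (by simpa [counter_append_cons] using this)
    refine cfg_eq rfl (by simp [contents]) fun k => ?_
    rcases k with _ | _ | _ | (_ | _) | (_ | _) | (_ | _) <;> simp [contents]

theorem run_zeroB : Runs (b + 1)
    ⟨some .zeroB, x, contents false i r o v v' j j' b b'⟩
    ⟨some .oneV, none,
      contents false i r (some true :: none :: (counter b ++ o)) v v' j j' 0 (b + b')⟩ := by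
  induction b generalizing x o b' with
  | zero =>
    refine .single (step_eq (cfg_eq rfl (by simp [contents]) fun k => ?_))
    rcases k with _ | _ | _ | (_ | _) | (_ | _) | (_ | _) <;> simp [contents]
  | succ b ih =>
    have := ih (x := some (some false)) (o := some false :: o) (b' := b' + 1)
    rw [show b + (b' + 1) = b + 1 + b' by omega] at this
    refine .head (step_eq ?_) (by simpa [counter_append_cons] using this)
    refine cfg_eq rfl (by simp [contents]) fun k => ?_
    rcases k with _ | _ | _ | (_ | _) | (_ | _) | (_ | _) <;> simp [contents]

theorem replicate_append_cons {β : Type*} (n : ℕ) (a : β) (l : List β) :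
    List.replicate n a ++ a :: l = a :: (List.replicate n a ++ l) := by
  induction n with
  | zero => rfl
  | succ n ih => simp [List.replicate_succ, ih]

theorem run_oneV : Runs (v' + 1)
    ⟨some .oneV, x, contents false i r o v v' j j' b b'⟩
    ⟨some .oneB, none,
      contents false i r (List.replicate v' (some true) ++ o) v 0 j j' b b'⟩ := by
  induction v' generalizing x o with
  | zero =>
    refine .single (step_eq (cfg_eq rfl (by simp [contents]) fun k => ?_))
    rcases k with _ | _ | _ | (_ | _) | (_ | _) | (_ | _) <;> simp [contents]
  | succ v' ih =>
    have := ih (x := some (some false)) (o := some true :: o)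
    refine .head (step_eq ?_) (by simpa [replicate_append_cons, List.replicate_succ] using this)
    refine cfg_eq rfl (by simp [contents]) fun k => ?_
    rcases k with _ | _ | _ | (_ | _) | (_ | _) | (_ | _) <;> simp [contents]

/-- Besides writing ones, this pass empties the last counter and resets the register, as a halting
configuration requires. -/
theorem run_oneB : Runs (b' + 1)
    ⟨some .oneB, x, contents false i r o v v' j j' b b'⟩
    ⟨none, none, contents false i r (List.replicate b' (some true) ++ o) v v' j j' b 0⟩ := by
  induction b' generalizing x o with
  | zero =>
    refine .single (step_eq (cfg_eq rfl (by simp [contents]) fun k => ?_))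
    rcases k with _ | _ | _ | (_ | _) | (_ | _) | (_ | _) <;> simp [contents]
  | succ b' ih =>
    have := ih (x := some (some false)) (o := some true :: o)
    refine .head (step_eq ?_) (by simpa [replicate_append_cons, List.replicate_succ] using this)
    refine cfg_eq rfl (by simp [contents]) fun k => ?_
    rcases k with _ | _ | _ | (_ | _) | (_ | _) | (_ | _) <;> simp [contents]

/-- After the last round, the machine writes the size of the ground set and the element. -/
theorem run_header : Runs (2 * (v + b) + 5)
    ⟨some .loop, x, contents false i r o v 0 0 0 b 0⟩
    ⟨none, none, contents false i r
      (List.replicate (v + b + 1) (some true) ++ none :: (counter (v + b) ++ some true :: none :: o))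
      0 0 0 0 0 0⟩ := by
  have h₁ : TM2.step program ⟨some .loop, x, contents false i r o v 0 0 0 b 0⟩ =
      some ⟨some .zeroV, none,
        contents false i r (some true :: none :: o) v 0 0 0 b 0⟩ := by
    refine step_eq (cfg_eq rfl (by simp [contents]) fun k => ?_)
    rcases k with _ | _ | _ | (_ | _) | (_ | _) | (_ | _) <;> simp [contents]
  have h₂ := (((run_zeroV.trans run_zeroB).trans run_oneV).trans run_oneB).head h₁
  have h₃ := h₂.mono (t := 2 * (v + b) + 5) (by omega)
  -- The 1 already pushed by `zeroB` accounts for the element `z` in the size of the ground set.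
  have e : ∀ w : List Letter, List.replicate b (some true) ++ (List.replicate v (some true) ++
      some true :: w) = List.replicate (v + b + 1) (some true) ++ w := by
    intro w
    rw [replicate_append_cons, replicate_append_cons, ← List.append_assoc,
      List.replicate_append_replicate, add_comm b v, List.replicate_succ, List.cons_append]
  have e' : ∀ w : List Letter, counter b ++ (counter v ++ w) = counter (v + b) ++ w := by
    intro w
    rw [counter, counter, ← List.append_assoc, List.replicate_append_replicate, add_comm b v,
      counter]
  simpa [e, e'] using h₃

/-! ### Reading the input -/

theorem run_readVertices (n : ℕ) : Runs (n + 1)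
    ⟨some .readVertices, x, contents false (encodeUnary n ++ i) r o v v' j j' b b'⟩
    ⟨some .readEdges, some none, contents false i r o (n + v) v' j j' b b'⟩ := by
  induction n generalizing x v with
  | zero =>
    simp only [encodeUnary, List.replicate_zero, List.nil_append, List.singleton_append]
    refine .single (step_eq (cfg_eq (by simp) (by simp [contents]) fun k => ?_))
    rcases k with _ | _ | _ | (_ | _) | (_ | _) | (_ | _) <;> simp [contents]
  | succ n ih =>
    have := ih (x := some (some true)) (v := v + 1)
    rw [show n + (v + 1) = n + 1 + v by omega] at this
    refine .head (step_eq (cfg_eq rfl (by simp [contents, encodeUnary, List.replicate_succ])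
      fun k => ?_)) this
    rcases k with _ | _ | _ | (_ | _) | (_ | _) | (_ | _) <;>
      simp [contents, encodeUnary, List.replicate_succ]

/-- The closing `#` is not stored; it is counted in `j`, which thereby becomes the number of edges.
-/
theorem run_readRow (l : List Bool) : Runs (l.length + 1)
    ⟨some .readEdges, x, contents false (l.map some ++ none :: i) r o v v' j j' b b'⟩
    ⟨some .readEdges, some none,
      contents false i ((l.map some).reverse ++ r) o v v' (j + 1) j' b b'⟩ := by
  induction l generalizing x r with
  | nil =>
    refine .single (step_eq (cfg_eq (by simp) (by simp [contents]) fun k => ?_))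
    rcases k with _ | _ | _ | (_ | _) | (_ | _) | (_ | _) <;> simp [contents]
  | cons a l ih =>
    have := ih (x := some (some a)) (r := some a :: r)
    refine .head (step_eq ?_) (by simpa using this)
    refine cfg_eq (by simp) (by simp [contents]) fun k => ?_
    rcases k with _ | _ | _ | (_ | _) | (_ | _) | (_ | _) <;> simp [contents]

theorem run_readEdges {n : ℕ} (ls : List (List Bool)) (hls : ∀ l ∈ ls, l.length = n) :
    Runs (ls.length * (n + 1) + 1)
      ⟨some .readEdges, x,
        contents false (ls.flatMap fun l => l.map some ++ [none]) r o v v' j j' b b'⟩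
      ⟨some .loop, none,
        contents false [] ((ls.map (List.map some)).flatten.reverse ++ r) o v v'
          (j + ls.length) j' b b'⟩ := by
  induction ls generalizing x r j with
  | nil =>
    refine ReachesWithin.mono (.single (step_eq ?_)) (by simp)
    refine cfg_eq (by simp) (by simp [contents]) fun k => ?_
    rcases k with _ | _ | _ | (_ | _) | (_ | _) | (_ | _) <;> simp [contents]
  | cons l ls ih =>
    have h₁ := (run_readRow l (x := x) (r := r) (o := o) (v := v) (v' := v') (j := j) (j' := j')
      (b := b) (b' := b')).trans (ih (fun m hm => hls m (by simp [hm])))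
    rw [hls l (by simp)] at h₁
    have h₂ := h₁.mono (t := (l :: ls).length * (n + 1) + 1) (by
      simp only [List.length_cons]
      nlinarith)
    have e : j + 1 + ls.length = j + (ls.length + 1) := by omega
    simpa [e] using h₂

/-- The machine on the word of a hypergraph. -/
theorem run_machine {n : ℕ} (ls : List (List Bool)) (hls : ∀ l ∈ ls, l.length = n) :
    Runs (10 * ((n + 1) * (ls.length + 1) + 1) ^ 2)
      ⟨some .readVertices, none, contents false
        (encodeUnary n ++ ls.flatMap fun l => l.map some ++ [none]) [] [] 0 0 0 0 0 0⟩
      ⟨none, none, contents false [] [] (List.replicate (n + ls.length + 1) (some true) ++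
        none :: (counter (n + ls.length) ++ some true :: none ::
          rowsOf n (ls.map (List.map some)) 0 0)) 0 0 0 0 0 0⟩ := by
  have h₁ := (run_readVertices n (x := none) (r := []) (o := []) (v := 0) (v' := 0) (j := 0)
    (j' := 0) (b := 0) (b' := 0)).trans (run_readEdges ls hls)
  have h₂ := run_loop (ls.map (List.map some)) (n := n) (by simpa using hls) (i := []) (o := [])
    (b := 0)
  simp only [List.length_map, add_zero, zero_add, List.append_nil] at h₁ h₂
  refine ((h₁.trans h₂).trans run_header).mono ?_
  -- The right side is the input length plus one, which turns a bound in `n + m` into one in the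
  -- input length.
  have hm : n + ls.length + 2 ≤ (n + 1) * (ls.length + 1) + 1 := by nlinarith
  calc _ ≤ 10 * (n + ls.length + 2) ^ 2 := by nlinarith
    _ ≤ _ := Nat.mul_le_mul_left _ (Nat.pow_le_pow_left hm 2)

/-! ### Agreement of the output with the encoded base -/

/-- The incidence vector of `E ∩ {0, …, n - 1}`. -/
def incidence (n : ℕ) (E : Finset ℕ) : List Bool :=
  (List.range n).map fun i => decide (i ∈ E)

theorem length_incidence (n : ℕ) (E : Finset ℕ) : (incidence n E).length = n := by
  simp [incidence]

theorem encodeRow_eq_incidence (n : ℕ) (E : Finset ℕ) :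
    encodeRow n E = (incidence n E).map some ++ [none] := by
  simp [encodeRow, incidence]

/-- Enlarging the ground set only appends zeros to the vector of an edge. -/
theorem incidence_add {n : ℕ} {E : Finset ℕ} (hE : E ⊆ Finset.range n) (k : ℕ) :
    (incidence (n + k) E).map some = (incidence n E).map some ++ counter k := by
  have h : ∀ i, n + i ∉ E := fun i hi => by simpa using hE hi
  simp [incidence, List.range_add, counter, Function.comp_def, h, List.map_const']

theorem encodeRow_edge {n : ℕ} {E : Finset ℕ} (hE : E ⊆ Finset.range n) (j b : ℕ) :
    encodeRow (n + j + b + 1) E = (incidence n E).map some ++ rowEnd j b false := by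
  rw [encodeRow_eq_incidence, show n + j + b + 1 = n + (j + (b + 1)) by omega, incidence_add hE,
    rowEnd, counter, ← List.replicate_append_replicate]
  simp [counter, List.replicate_succ]

theorem encodeRow_singleton (k b : ℕ) :
    encodeRow (k + b + 1) {k} = counter k ++ some true :: (counter b ++ [none]) := by
  have h : incidence (k + 1) {k} = List.replicate k false ++ [true] := by
    simp only [incidence, List.range_succ, List.map_append, Finset.mem_singleton]
    congr 1
    · rw [List.eq_replicate_iff]
      simp +contextual [Nat.ne_of_lt]
    · simp
  rw [encodeRow_eq_incidence, show k + b + 1 = k + 1 + b by omega, incidence_add (by simp), h]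
  simp [counter]

theorem counter_append_rowEnd (v j b : ℕ) :
    counter v ++ rowEnd j b true = encodeRow (v + j + b + 1) {v + j} := by
  rw [encodeRow_singleton, rowEnd, ← List.append_assoc]
  simp only [counter, List.replicate_append_replicate]

/-- The slack `b` keeps the row length fixed while the induction drops the last edge. -/
theorem flatMap_chainImplications {n : ℕ} {es : List (Finset ℕ)}
    (hes : ∀ E ∈ es, E ⊆ Finset.range n) (b : ℕ) :
    (chainImplications n es).flatMap (fun i => encodeRow (n + es.length + b + 1) i.1 ++
        encodeRow (n + es.length + b + 1) i.2) =
      rowsOf n (es.map fun E => (incidence n E).map some) 0 b := by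
  induction es using List.reverseRecOn generalizing b with
  | nil => simp [chainImplications, rowsOf]
  | append_singleton es E ih =>
    have hE : E ⊆ Finset.range n := hes E (by simp)
    have e₁ : n + (es ++ [E]).length + b + 1 = n + es.length + (b + 1) + 1 := by
      simp only [List.length_append, List.length_singleton]
      omega
    have e₂ : n + es.length + (b + 1) + 1 = n + (es.length + 1) + b + 1 := by omega
    rw [e₁, chainImplications_concat, List.flatMap_append, ih fun F hF => hes F (by simp [hF]),
      List.map_append, List.map_singleton, rowsOf_concat]
    simp only [List.flatMap_cons, List.flatMap_nil, List.length_map, zero_add,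
      counter_append_rowEnd, ← e₂, encodeRow_edge hE, List.append_nil, List.append_assoc,
      add_assoc n es.length 1]

theorem encode_toAttached (I : HypergraphInstance) :
    I.toAttached.encode = List.replicate (I.n + I.edges.length + 1) (some true) ++
      none :: (counter (I.n + I.edges.length) ++ some true :: none ::
        rowsOf I.n ((I.edges.map (incidence I.n)).map (List.map some)) 0 0) := by
  have h₁ := flatMap_chainImplications I.edges_subset 0
  have h₂ := encodeRow_singleton (I.n + I.edges.length) 0
  simp only [add_zero, counter_zero, List.nil_append] at h₁ h₂
  change encodeUnary (I.n + I.edges.length + 1) ++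
    (encodeRow (I.n + I.edges.length + 1) {I.n + I.edges.length} ++
      (chainImplications I.n I.edges).flatMap (fun i => encodeRow (I.n + I.edges.length + 1) i.1 ++
        encodeRow (I.n + I.edges.length + 1) i.2)) = _
  rw [h₁, h₂]
  simp [encodeUnary, Function.comp_def]

theorem encode_eq (I : HypergraphInstance) :
    I.encode = encodeUnary I.n ++
      (I.edges.map (incidence I.n)).flatMap fun l => l.map some ++ [none] := by
  simp only [HypergraphInstance.encode, List.flatMap_map, ← encodeRow_eq_incidence]

theorem length_encode (I : HypergraphInstance) :
    I.encode.length = (I.n + 1) * (I.edges.length + 1) := by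
  have : ∀ es : List (Finset ℕ),
      (es.flatMap (encodeRow I.n)).length = es.length * (I.n + 1) := by
    intro es
    induction es with
    | nil => simp
    | cons E es ih =>
      rw [List.flatMap_cons, List.length_append, ih]
      simp only [encodeRow, List.length_append, List.length_map, List.length_range,
        List.length_cons, List.length_nil]
      ring
  rw [HypergraphInstance.encode, List.length_append, this]
  simp only [encodeUnary, List.length_append, List.length_replicate, List.length_singleton]
  ring

theorem initList_machine (w : List Letter) : initList machine w =
    (⟨some .readVertices, none, contents false w [] [] 0 0 0 0 0 0⟩ : Cfg) := by
  refine cfg_eq rfl rfl fun k => ?_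
  rcases k with _ | _ | _ | (_ | _) | (_ | _) | (_ | _) <;> rfl

theorem haltList_machine (w : List Letter) : haltList machine w =
    (⟨none, none, contents false [] [] w 0 0 0 0 0 0⟩ : Cfg) := by
  refine cfg_eq rfl rfl fun k => ?_
  rcases k with _ | _ | _ | (_ | _) | (_ | _) | (_ | _) <;> rfl

theorem nonempty_outputsInTime (I : HypergraphInstance) :
    Nonempty (TM2OutputsInTime machine I.encode (some I.toAttached.encode)
      ((10 * (Polynomial.X + 1) ^ 2 : Polynomial ℕ).eval I.encode.length)) := by
  refine ReachesWithin.nonempty_evalsToInTime ?_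
  have h := run_machine (n := I.n) (I.edges.map (incidence I.n)) (by simp [length_incidence])
  rw [initList_machine, haltList_machine, encode_toAttached, length_encode, encode_eq]
  have e : (10 * (Polynomial.X + 1) ^ 2 : Polynomial ℕ).eval
      ((I.n + 1) * (I.edges.length + 1)) =
      10 * ((I.n + 1) * ((I.edges.map (incidence I.n)).length + 1) + 1) ^ 2 := by
    simp
  rw [e]
  rw [List.length_map] at h ⊢
  exact h

/-- The reduction is computed in polynomial time, from any subtype of the instances. -/
theorem nonempty_computableInPolyTime {A B : Type} {ea : A → List Letter} {eb : B → List Letter}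
    {f : A → B} (g : A → HypergraphInstance) (ha : ∀ a, ea a = (g a).encode)
    (hb : ∀ a, eb (f a) = (g a).toAttached.encode) :
    Nonempty (TM2ComputableInPolyTime ea eb f) :=
  ⟨{ tm := machine
     inputAlphabet := Equiv.refl _
     outputAlphabet := Equiv.refl _
     time := 10 * (Polynomial.X + 1) ^ 2
     outputsFun := fun a => by
      have h := (nonempty_outputsInTime (g a)).some
      rw [← ha, ← hb] at h
      -- Both alphabet equivalences are the identity, so the translated words are the words
      -- themselves.
      exact (List.map_id (ea a)).symm ▸ (List.map_id (eb (f a))).symm ▸ h }⟩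

end ReductionMachine

theorem mainTheorem11 :
    (ACSEnum.restrict fun I : AttachedInstance =>
        I.base.IsAcyclic ∧ I.base.conclusionDegree ≤ 2).IsHardFor MISEnum ∧
    (ACSEnum.restrict fun I : AttachedInstance =>
        I.base.IsAcyclic ∧ I.base.conclusionDegree ≤ 2 ∧ I.base.IsClosedSet ∅).IsHardFor
      (MISEnum.restrict fun I : HypergraphInstance => ∅ ∉ I.toHypergraph.edgeSet) := by
  -- One construction and one machine serve both claims, since restricting a problem leaves its
  -- encoding unchanged.
  refine ⟨⟨fun I => ⟨HypergraphInstance.toAttached I,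
      HypergraphInstance.isAcyclic_toAttached I,
      HypergraphInstance.conclusionDegree_toAttached_le I⟩,
    ReductionMachine.nonempty_computableInPolyTime (fun I => I) (fun _ => rfl) fun _ => rfl,
    fun I => HypergraphInstance.irr_toAttached I⟩,
    ⟨fun I => ⟨HypergraphInstance.toAttached I.1,
      HypergraphInstance.isAcyclic_toAttached I.1,
      HypergraphInstance.conclusionDegree_toAttached_le I.1,
      HypergraphInstance.isClosedSet_empty_toAttached I.1 I.2⟩,
    ReductionMachine.nonempty_computableInPolyTime (fun I => I.1) (fun _ => rfl) fun _ => rfl,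
    fun I => HypergraphInstance.irr_toAttached I.1⟩⟩
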